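/- Let $K$ be a field of characteristic zero. For a Lie algebra $\mathfrak L$ over $K$ and a functional $F\in\mathfrak L^*$ put $B_F(x,y)=F([x,y])$ for $x,y\in\mathfrak L$. The index of $\mathfrak L$ is $\operatorname{ind}\mathfrak L=\min_{F\in\mathfrak L^*}\dim\ker B_F$, and $\mathfrak L$ is called Frobenius if $\operatorname{ind}\mathfrak L=0$. Let $\underline x=(a_1,\dots,a_m)$ and $\underline y=(b_1,\dots,b_t)$ be sequences of non-negative integers, each with sum $n\ge 1$, and let $e_1,\dots,e_n$ be the standard basis of $K^n$. The seaweed Lie algebra $\mathfrak p(\underline x\mid\underline y)$ is the subalgebra of all $A\in\mathfrak{sl}(n,K)$ that map each of the subspaces $$V_i=\operatorname{span}\{e_1,\dots,e_{a_1+\cdots+a_i}\}\ (0\le i\le m),\qquad W_j=\operatorname{span}\{e_{b_1+\cdots+b_j+1},\dots,e_n\}\ (0\le j\le t)$$ into itself. **Corollary.** Let $a,b\ge 0$ be integers with $n=a+b\ge 1$. The (maximal parabolic) seaweed Lie algebra $\mathfrak p(a,b\mid n)$ is Frobenius if and only if $\gcd(a,n)=1$. -/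

import Mathlib

attribute [local instance 100] LieRing.ofAssociativeRing

namespace Seaweed

section Index

variable (K : Type*) [Field K] {L : Type*} [LieRing L] [LieAlgebra K L]

/-- The skew bilinear form `B_F(x, y) = F([x, y])` attached to a functional `F` on a Lie algebra. -/
def kirillovForm (F : Module.Dual K L) : L →ₗ[K] L →ₗ[K] K :=
  LinearMap.mk₂ K (fun x y => F ⁅x, y⁆)
    (fun x y z => by simp) (fun c x y => by simp) (fun x y z => by simp) (fun c x y => by simp)

variable (L)

/-- The index of a Lie algebra: the minimum, over all functionals `F`, of `dim (ker B_F)`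
(the dimension is taken as a cardinal, so the minimum is always attained). -/
noncomputable def index : Cardinal :=
  ⨅ F : Module.Dual K L, Module.rank K (LinearMap.ker (kirillovForm K F))

/-- A Lie algebra is Frobenius if its index is zero. -/
def IsFrobenius : Prop := index K L = 0

end Index

/-- A composition of `n`, zero parts being allowed. -/
structure WeakComposition (n : ℕ) where
  /-- the parts, in order -/
  parts : List ℕ
  /-- the parts add up to `n` -/
  sum_parts : parts.sum = n

section Algebra

variable (K : Type*) [Field K] {n : ℕ}

/-- The span of the first `k` vectors of the standard basis of `K ^ n`. -/
def initialSpan (n k : ℕ) : Submodule K (Fin n → K) :=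
  Submodule.span K ((fun i : Fin n => (Pi.single i (1 : K) : Fin n → K)) '' {i | (i : ℕ) < k})

/-- The span of all but the first `k` vectors of the standard basis of `K ^ n`. -/
def finalSpan (n k : ℕ) : Submodule K (Fin n → K) :=
  Submodule.span K ((fun i : Fin n => (Pi.single i (1 : K) : Fin n → K)) '' {i | k ≤ (i : ℕ)})

/-- The matrix `A`, acting on column vectors, maps the subspace `U` into itself. -/
def Preserves (A : Matrix (Fin n) (Fin n) K) (U : Submodule K (Fin n → K)) : Prop :=
  ∀ v ∈ U, A.mulVec v ∈ U

/-- The seaweed Lie algebra `𝔭(x | y)`: the subalgebra of `𝔰𝔩(n)` preserving the ascending flag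
`V_i = span {e_1, …, e_{x_1 + ⋯ + x_i}}` and the descending flag
`W_j = span {e_{y_1 + ⋯ + y_j + 1}, …, e_n}`. -/
def seaweed (x y : WeakComposition n) :
    LieSubalgebra K (LieAlgebra.SpecialLinear.sl (Fin n) K) where
  carrier := {A |
    (∀ i ≤ x.parts.length, Preserves K A.val (initialSpan K n (x.parts.take i).sum)) ∧
    (∀ j ≤ y.parts.length, Preserves K A.val (finalSpan K n (y.parts.take j).sum))}
  add_mem' := by
    rintro A B ⟨hA, hA'⟩ ⟨hB, hB'⟩
    constructor
    · intro i hi v hv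
      simpa [Matrix.add_mulVec] using add_mem (hA i hi v hv) (hB i hi v hv)
    · intro i hi v hv
      simpa [Matrix.add_mulVec] using add_mem (hA' i hi v hv) (hB' i hi v hv)
  zero_mem' := by
    constructor <;> intro i _ v _ <;> simp
  smul_mem' := by
    rintro c A ⟨hA, hA'⟩
    constructor
    · intro i hi v hv
      simpa [Matrix.smul_mulVec] using Submodule.smul_mem _ c (hA i hi v hv)
    · intro i hi v hv
      simpa [Matrix.smul_mulVec] using Submodule.smul_mem _ c (hA' i hi v hv)
  lie_mem' := by
    rintro A B ⟨hA, hA'⟩ ⟨hB, hB'⟩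
    constructor
    · intro i hi v hv
      rw [LieAlgebra.SpecialLinear.sl_bracket, Matrix.sub_mulVec, ← Matrix.mulVec_mulVec,
        ← Matrix.mulVec_mulVec]
      exact sub_mem (hA i hi _ (hB i hi v hv)) (hB i hi _ (hA i hi v hv))
    · intro i hi v hv
      rw [LieAlgebra.SpecialLinear.sl_bracket, Matrix.sub_mulVec, ← Matrix.mulVec_mulVec,
        ← Matrix.mulVec_mulVec]
      exact sub_mem (hA' i hi _ (hB' i hi v hv)) (hB' i hi _ (hA' i hi v hv))

end Algebra

end Seaweed

/-! Via the trace form, a functional on the block upper triangular `X = (x, y; 0, z)` is a block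
lower triangular `f = (A, 0; C, D)`, and `X` lies in its kernel iff `f * X - X * f` vanishes outside
the upper right block. Scalars always satisfy this; in characteristic zero they split off from the
trace-zero part, so Frobenius means that some `f` is rigid (`isFrobenius_parabolic_iff`).

Rigidity obeys the subtractive Euclidean algorithm. For `a ≤ b`, rigidity makes `C` injective
(`IsRigid.mulVec_injective`); a change of basis makes it `(1; 0)`, and eliminating variables leaves
the same problem of size `(a, b - a)` (`existsRigid_sum_iff`). Sizes may be swapped by
transposition, and size `(0, b)` is rigid only for `b = 1`. Hence the criterion is `gcd(a, b) = 1`,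
and `gcd(a, b) = gcd(a, a + b)`. -/

namespace Seaweed

open Matrix

/-! ### Rigid triples and their symmetries -/

section Triples

variable {K : Type*} [Field K] {m n u : Type} [Fintype m] [Fintype n] [Fintype u]
  [DecidableEq m] [DecidableEq n] [DecidableEq u]

/-- The stabilizer of the block lower triangular matrix `(A, 0; C, D)`, as a functional on the
block upper triangular matrices `(x, y; 0, z)`, consists of scalar matrices. -/
def IsRigid (A : Matrix m m K) (C : Matrix n m K) (D : Matrix n n K) : Prop :=
  ∀ (x : Matrix m m K) (y : Matrix m n K) (z : Matrix n n K),
    A * x = x * A + y * C → C * x = z * C → C * y + D * z = z * D →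
      ∃ c : K, x = c • (1 : Matrix m m K) ∧ y = 0 ∧ z = c • (1 : Matrix n n K)

variable (K m n) in
/-- Some functional on the block upper triangular matrices has only scalars in its stabilizer. -/
def ExistsRigid : Prop :=
  ∃ (A : Matrix m m K) (C : Matrix n m K) (D : Matrix n n K), IsRigid A C D

theorem IsRigid.transpose {A : Matrix m m K} {C : Matrix n m K} {D : Matrix n n K}
    (h : IsRigid A C D) : IsRigid Dᵀ Cᵀ Aᵀ := by
  intro x y z h1 h2 h3
  have h1' := congrArg Matrix.transpose h1
  have h2' := congrArg Matrix.transpose h2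
  have h3' := congrArg Matrix.transpose h3
  simp only [transpose_mul, transpose_add, transpose_transpose] at h1' h2' h3'
  obtain ⟨c, hz, hy, hx⟩ := h zᵀ yᵀ xᵀ (by rw [← h3', add_comm]) h2'.symm
    (by rw [h1', add_comm])
  refine ⟨c, ?_, ?_, ?_⟩
  · simpa using congrArg Matrix.transpose hx
  · simpa using congrArg Matrix.transpose hy
  · simpa using congrArg Matrix.transpose hz

theorem existsRigid_comm : ExistsRigid K m n ↔ ExistsRigid K n m :=
  ⟨fun ⟨_, _, _, h⟩ => ⟨_, _, _, h.transpose⟩, fun ⟨_, _, _, h⟩ => ⟨_, _, _, h.transpose⟩⟩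

theorem ExistsRigid.reindex (e : u ≃ n) (h : ExistsRigid K m n) : ExistsRigid K m u := by
  obtain ⟨A, C, D, h⟩ := h
  refine ⟨A, C.submatrix e id, D.submatrix e e, fun x y z h1 h2 h3 => ?_⟩
  have hy : y = (y.submatrix id e.symm).submatrix id e := by simp
  have hz : z = (z.submatrix e.symm e.symm).submatrix e e := by simp
  generalize y.submatrix id e.symm = y' at hy
  generalize z.submatrix e.symm e.symm = z' at hz
  subst hy hz
  obtain ⟨c, hx, hy, hz⟩ := h x y' z' (by simpa using h1)
    (by
      have := congrArg (fun M => M.submatrix e.symm id) h2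
      ext i j
      have := congrFun (congrFun this i) j
      simpa [Matrix.mul_apply, Equiv.sum_comp e (fun k => z' i k * C k j)] using this)
    (by
      have := congrArg (fun M => M.submatrix e.symm e.symm) h3
      ext i j
      have := congrFun (congrFun this i) j
      simpa [Matrix.mul_apply, Equiv.sum_comp e (fun k => z' i k * D k j),
        Equiv.sum_comp e (fun k => D i k * z' k j)] using this)
  refine ⟨c, hx, by simp [hy], ?_⟩
  rw [hz]
  ext i j
  simp [Matrix.one_apply]

theorem IsRigid.conj {A : Matrix m m K} {C : Matrix n m K} {D : Matrix n n K}
    (h : IsRigid A C D) {P Q : Matrix n n K} (hPQ : P * Q = 1) :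
    IsRigid A (P * C) (P * D * Q) := by
  have hQP : Q * P = 1 := mul_eq_one_comm.mp hPQ
  intro x y z h1 h2 h3
  obtain ⟨c, hx, hy, hz⟩ := h x (y * P) (Q * z * P) (by rw [h1, Matrix.mul_assoc y])
    (by
      calc C * x = (Q * P) * C * x := by rw [hQP, Matrix.one_mul]
        _ = Q * (P * C * x) := by simp only [Matrix.mul_assoc]
        _ = Q * z * P * C := by rw [h2]; simp only [Matrix.mul_assoc])
    (by
      calc C * (y * P) + D * (Q * z * P)
          = (Q * P) * (C * (y * P)) + (Q * P) * (D * (Q * z * P)) := by simp [hQP]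
        _ = Q * (P * C * y + P * D * Q * z) * P := by
            simp only [Matrix.mul_assoc, Matrix.mul_add, Matrix.add_mul]
        _ = Q * z * P * D * (Q * P) := by rw [h3]; simp only [Matrix.mul_assoc]
        _ = Q * z * P * D := by rw [hQP, Matrix.mul_one])
  refine ⟨c, hx, ?_, ?_⟩
  · calc y = y * P * Q := by rw [Matrix.mul_assoc, hPQ, Matrix.mul_one]
      _ = 0 := by rw [hy, Matrix.zero_mul]
  · calc z = (P * Q) * z * (P * Q) := by rw [hPQ, Matrix.one_mul, Matrix.mul_one]
      _ = P * (Q * z * P) * Q := by simp only [Matrix.mul_assoc]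
      _ = c • 1 := by rw [hz]; simp [hPQ]

/-- For `C = (1; 0)`, the equation `C * x = z * C` forces `z = (x, z₁₂; 0, z₂₂)`, and the top row of
the third equation determines `y`. What remains is the smaller system in `x, z₁₂, z₂₂`. -/
theorem isRigid_fromRows_one_zero_iff {A : Matrix m m K} {D₁₁ : Matrix m m K}
    {D₁₂ : Matrix m u K} {D₂₁ : Matrix u m K} {D₂₂ : Matrix u u K} :
    IsRigid A (fromRows (1 : Matrix m m K) (0 : Matrix u m K)) (fromBlocks D₁₁ D₁₂ D₂₁ D₂₂) ↔
      IsRigid (A + D₁₁) D₂₁ D₂₂ := by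
  constructor
  · intro h x y z h1 h2 h3
    obtain ⟨c, hx, -, hz⟩ := h x
      (fromCols (A * x - x * A) (x * D₁₂ + y * D₂₂ - D₁₁ * y - D₁₂ * z)) (fromBlocks x y 0 z)
      (by simp [fromCols_mul_fromRows])
      (by
        rw [fromRows_mul, fromBlocks_mul_fromRows]
        simp)
      (by
        rw [fromRows_mul_fromCols, fromBlocks_multiply, fromBlocks_multiply, fromBlocks_add]
        rw [add_mul, mul_add] at h1
        have h1' : D₁₁ * x = x * A + x * D₁₁ + y * D₂₁ - A * x := by rw [← h1]; abel
        simp [h2, h3, h1']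
        abel)
    rw [← fromBlocks_one, fromBlocks_smul, fromBlocks_inj] at hz
    exact ⟨c, hx, by simpa using hz.2.1, hz.2.2.2⟩
  · intro h x y z h1 h2 h3
    obtain ⟨y₁, y₂, rfl⟩ : ∃ y₁ y₂, y = fromCols y₁ y₂ := ⟨_, _, (fromCols_toCols y).symm⟩
    obtain ⟨z₁₁, z₁₂, z₂₁, z₂₂, rfl⟩ : ∃ z₁₁ z₁₂ z₂₁ z₂₂, z = fromBlocks z₁₁ z₁₂ z₂₁ z₂₂ :=
      ⟨_, _, _, _, (fromBlocks_toBlocks z).symm⟩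
    rw [fromCols_mul_fromRows, Matrix.mul_one, Matrix.mul_zero, add_zero] at h1
    rw [fromRows_mul, fromBlocks_mul_fromRows, fromRows_ext_iff] at h2
    rw [fromRows_mul_fromCols, fromBlocks_multiply, fromBlocks_multiply, fromBlocks_add,
      fromBlocks_inj] at h3
    simp only [Matrix.mul_one, Matrix.one_mul, Matrix.mul_zero, Matrix.zero_mul, add_zero,
      zero_add] at h2 h3
    obtain ⟨rfl, rfl⟩ := h2
    simp only [Matrix.mul_zero, Matrix.zero_mul, add_zero, zero_add] at h3
    obtain ⟨e₁₁, e₁₂, e₂₁, e₂₂⟩ := h3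
    obtain ⟨c, rfl, rfl, rfl⟩ := h x z₁₂ z₂₂
      (by rw [add_mul, mul_add, h1, add_assoc, add_assoc, e₁₁])
      e₂₁ e₂₂
    have hy₁ : y₁ = 0 := by simpa using e₁₁
    have hy₂ : y₂ = 0 := by simpa using e₁₂
    refine ⟨c, rfl, by simp [hy₁, hy₂], ?_⟩
    rw [← fromBlocks_one, fromBlocks_smul]
    simp

end Triples

/-! ### Reduction step and base case -/

section Rank

variable {K : Type*} [Field K] {m n u : Type} [Fintype m] [Fintype n] [Fintype u]
  [DecidableEq m] [DecidableEq n] [DecidableEq u]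

/-- If `C v = 0` with `v ≠ 0`, the size condition yields `w ≠ 0` with `w C = 0`; then `x = z = 0`,
`y = v wᵀ` is a nonscalar solution. -/
theorem IsRigid.mulVec_injective {A : Matrix m m K} {C : Matrix n m K} {D : Matrix n n K}
    (h : IsRigid A C D) (hmn : Fintype.card m ≤ Fintype.card n) :
    Function.Injective C.mulVecLin := by
  by_contra hC
  have hker : LinearMap.ker C.mulVecLin ≠ ⊥ := fun hk => hC (LinearMap.ker_eq_bot.mp hk)
  obtain ⟨v, hv, hv0⟩ := Submodule.exists_mem_ne_zero_of_ne_bot hker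
  have hr := LinearMap.finrank_range_add_finrank_ker C.mulVecLin
  have hpos : 0 < Module.finrank K (LinearMap.ker C.mulVecLin) :=
    Nat.pos_of_ne_zero fun h0 => hker (Submodule.finrank_eq_zero.mp h0)
  have hrT := LinearMap.finrank_range_add_finrank_ker Cᵀ.mulVecLin
  have hrank : Module.finrank K (LinearMap.range Cᵀ.mulVecLin) =
      Module.finrank K (LinearMap.range C.mulVecLin) := C.rank_transpose
  rw [Module.finrank_fintype_fun_eq_card] at hr hrT
  have hkerT : LinearMap.ker Cᵀ.mulVecLin ≠ ⊥ := by
    intro h0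
    rw [h0, finrank_bot] at hrT
    omega
  obtain ⟨w, hw, hw0⟩ := Submodule.exists_mem_ne_zero_of_ne_bot hkerT
  rw [LinearMap.mem_ker, mulVecLin_apply] at hv hw
  rw [mulVec_transpose] at hw
  obtain ⟨c, -, hy, -⟩ := h 0 (vecMulVec v w) 0
    (by simp [vecMulVec_mul, hw]) (by simp) (by simp [mul_vecMulVec, hv])
  obtain ⟨i, hi⟩ := Function.ne_iff.mp hv0
  obtain ⟨j, hj⟩ := Function.ne_iff.mp hw0
  have := congrFun (congrFun hy i) j
  rw [vecMulVec_apply] at this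
  exact mul_ne_zero hi hj this

theorem exists_mul_eq_fromRows_one_zero {C : Matrix (m ⊕ u) m K}
    (hC : Function.Injective C.mulVecLin) :
    ∃ P Q : Matrix (m ⊕ u) (m ⊕ u) K, P * Q = 1 ∧
      P * C = fromRows (1 : Matrix m m K) (0 : Matrix u m K) := by
  have hI : Function.Injective
      (fromRows (1 : Matrix m m K) (0 : Matrix u m K)).mulVecLin := by
    intro v w hvw
    simp only [mulVecLin_apply, fromRows_mulVec, one_mulVec] at hvw
    exact funext fun i => congrFun hvw (Sum.inl i)
  -- The isomorphism between the two ranges extends to an automorphism of the whole space.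
  obtain ⟨g, hg⟩ := Submodule.exists_linearEquiv_restrict_eq
    ((LinearEquiv.ofInjective _ hC).symm.trans (LinearEquiv.ofInjective _ hI))
  refine ⟨LinearMap.toMatrix' g.toLinearMap, LinearMap.toMatrix' g.symm.toLinearMap, ?_, ?_⟩
  · rw [← LinearMap.toMatrix'_comp]
    simp
  · apply Matrix.toLin'.injective
    ext1 i
    ext1
    have := hg (LinearEquiv.ofInjective _ hC (Pi.single i 1))
    simp only [LinearEquiv.trans_apply, LinearEquiv.symm_apply_apply,
      LinearEquiv.ofInjective_apply] at this
    rw [Matrix.toLin'_mul, Matrix.toLin'_toMatrix']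
    simpa using this.symm

theorem existsRigid_sum_iff : ExistsRigid K m (m ⊕ u) ↔ ExistsRigid K m u := by
  constructor
  · rintro ⟨A, C, D, h⟩
    obtain ⟨P, Q, hPQ, hPC⟩ := exists_mul_eq_fromRows_one_zero (h.mulVec_injective (by simp))
    have h' := h.conj hPQ
    rw [hPC, ← fromBlocks_toBlocks (P * D * Q), isRigid_fromRows_one_zero_iff] at h'
    exact ⟨_, _, _, h'⟩
  · rintro ⟨A, C, D, h⟩
    -- Only the sum of `0` and the corner `A` matters.
    refine ⟨0, fromRows 1 0, fromBlocks A 0 C D, isRigid_fromRows_one_zero_iff.mpr ?_⟩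
    rwa [zero_add]

/-- Here rigidity says that `D` commutes only with scalars. As `D` commutes with itself it is
scalar, so every matrix is scalar. -/
theorem existsRigid_of_isEmpty_iff [IsEmpty m] [Nonempty n] :
    ExistsRigid K m n ↔ Fintype.card n = 1 := by
  constructor
  · rintro ⟨A, C, D, h⟩
    obtain ⟨d, -, -, rfl⟩ := h 0 0 D (Subsingleton.elim _ _) (Subsingleton.elim _ _) (by simp)
    obtain ⟨i⟩ := ‹Nonempty n›
    refine Fintype.card_eq_one_iff.mpr ⟨i, fun j => ?_⟩
    by_contra hji
    obtain ⟨c, -, -, hc⟩ := h 0 0 (single i i 1) (Subsingleton.elim _ _)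
      (Subsingleton.elim _ _) (by simp)
    have h1 := congrFun (congrFun hc i) i
    have h2 := congrFun (congrFun hc j) j
    simp [Ne.symm hji] at h1 h2
    exact one_ne_zero (h1.trans h2.symm)
  · intro hn
    obtain ⟨i, hi⟩ := Fintype.card_eq_one_iff.mp hn
    refine ⟨0, 0, 0, fun x y z _ _ _ => ⟨z i i, Subsingleton.elim _ _, Subsingleton.elim _ _, ?_⟩⟩
    ext j k
    rw [hi j, hi k]
    simp

end Rank

theorem existsRigid_fin_iff (K : Type*) [Field K] (a b : ℕ) (hab : 0 < a + b) :
    ExistsRigid K (Fin a) (Fin b) ↔ Nat.gcd a b = 1 := by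
  induction hs : a + b using Nat.strong_induction_on generalizing a b with
  | _ s ih =>
    subst hs
    wlog hle : a ≤ b generalizing a b
    · rw [existsRigid_comm, Nat.gcd_comm]
      exact this b a (by omega) (fun s hs a' b' h1 h2 => ih s (by omega) a' b' h1 h2) (by omega)
    obtain ⟨u, rfl⟩ := Nat.exists_eq_add_of_le hle
    rcases Nat.eq_zero_or_pos a with rfl | ha
    · have : Nonempty (Fin (0 + u)) := ⟨⟨0, by omega⟩⟩
      rw [existsRigid_of_isEmpty_iff]
      simp
    · rw [Nat.gcd_self_add_right, ← ih (a + u) (by omega) a u (by omega) rfl,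
        ← existsRigid_sum_iff (u := Fin u)]
      exact ⟨fun h => h.reindex finSumFinEquiv, fun h => h.reindex finSumFinEquiv.symm⟩

/-! ### Trace form and kernel equations -/

section Coadjoint

theorem fromBlocks_sub_fromBlocks {K m n : Type*} [Ring K] (A A' : Matrix m m K) (B B' : Matrix m n K)
    (C C' : Matrix n m K) (D D' : Matrix n n K) :
    fromBlocks A B C D - fromBlocks A' B' C' D' =
      fromBlocks (A - A') (B - B') (C - C') (D - D') := by
  simp only [sub_eq_add_neg, fromBlocks_neg, fromBlocks_add]

variable {K : Type*} [Field K] {m n : Type} [Fintype m] [Fintype n]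

theorem trace_eq_trace_toBlocks (M : Matrix (m ⊕ n) (m ⊕ n) K) :
    trace M = trace M.toBlocks₁₁ + trace M.toBlocks₂₂ :=
  Fintype.sum_sum_type _

theorem trace_mul_commutator (f X Y : Matrix m m K) :
    trace (f * (X * Y - Y * X)) = trace ((f * X - X * f) * Y) := by
  rw [mul_sub, sub_mul, trace_sub, trace_sub, ← Matrix.mul_assoc, ← Matrix.mul_assoc f,
    trace_mul_comm (f * Y), Matrix.mul_assoc X]

/-- The three equations leave only the upper right block of `f * X - X * f`, which the trace form
pairs to zero with block upper triangular matrices. -/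
theorem trace_fromBlocks_mul_commutator_eq_zero {A : Matrix m m K} {B : Matrix m n K}
    {C : Matrix n m K} {D : Matrix n n K} {x : Matrix m m K} {y : Matrix m n K} {z : Matrix n n K}
    (h1 : A * x = x * A + y * C) (h2 : C * x = z * C) (h3 : C * y + D * z = z * D)
    (x' : Matrix m m K) (y' : Matrix m n K) (z' : Matrix n n K) :
    trace (fromBlocks A B C D * (fromBlocks x y 0 z * fromBlocks x' y' 0 z' -
      fromBlocks x' y' 0 z' * fromBlocks x y 0 z)) = 0 := by
  rw [trace_mul_commutator, fromBlocks_multiply, fromBlocks_multiply, fromBlocks_sub_fromBlocks]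
  simp [h1, h2, h3, fromBlocks_multiply, trace_eq_trace_toBlocks]

theorem equations_of_trace_mul_commutator_eq_zero [DecidableEq m] [DecidableEq n]
    (hcard : ((Fintype.card m + Fintype.card n : ℕ) : K) ≠ 0) {A : Matrix m m K}
    {C : Matrix n m K} {D : Matrix n n K} {x : Matrix m m K} {y : Matrix m n K} {z : Matrix n n K}
    (h : ∀ (x' : Matrix m m K) (y' : Matrix m n K) (z' : Matrix n n K), trace x' + trace z' = 0 →
      trace (fromBlocks A 0 C D * (fromBlocks x y 0 z * fromBlocks x' y' 0 z' -
        fromBlocks x' y' 0 z' * fromBlocks x y 0 z)) = 0) :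
    A * x = x * A + y * C ∧ C * x = z * C ∧ C * y + D * z = z * D := by
  simp only [trace_mul_commutator] at h
  obtain ⟨N, hN⟩ : ∃ N, N = fromBlocks A 0 C D * fromBlocks x y 0 z -
      fromBlocks x y 0 z * fromBlocks A 0 C D := ⟨_, rfl⟩
  rw [← hN] at h
  have htr : trace N = 0 := by rw [hN, trace_sub, trace_mul_comm, sub_self]
  have hall : ∀ (x' : Matrix m m K) (y' : Matrix m n K) (z' : Matrix n n K),
      trace (N * fromBlocks x' y' 0 z') = 0 := by
    intro x' y' z'
    -- Subtracting `t • 1` makes the test matrix trace-free; this costs nothing, since the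
    -- commutator `N` has trace zero.
    obtain ⟨t, ht⟩ : ∃ t : K, t * ((Fintype.card m + Fintype.card n : ℕ) : K) =
        trace x' + trace z' := ⟨_, div_mul_cancel₀ _ hcard⟩
    have hY : fromBlocks x' y' 0 z' =
        fromBlocks (x' - t • 1) y' 0 (z' - t • 1) + t • (1 : Matrix (m ⊕ n) (m ⊕ n) K) := by
      rw [← fromBlocks_one, fromBlocks_smul, fromBlocks_add]
      simp
    rw [hY, mul_add, trace_add, h _ _ _ ?_]
    · simp [htr]
    · simp only [trace_sub, trace_smul, trace_one, smul_eq_mul]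
      push_cast at ht
      linear_combination -ht
  rw [← fromBlocks_toBlocks N] at hall
  simp only [fromBlocks_multiply, trace_eq_trace_toBlocks, toBlocks_fromBlocks₁₁,
    toBlocks_fromBlocks₂₂] at hall
  rw [fromBlocks_multiply, fromBlocks_multiply, fromBlocks_sub_fromBlocks] at hN
  have e₁ : N.toBlocks₁₁ = 0 := ext_iff_trace_mul_right.mpr fun x' => by
    simpa using hall x' 0 0
  have e₂ : N.toBlocks₂₁ = 0 := ext_iff_trace_mul_right.mpr fun y' => by
    simpa using hall 0 y' 0
  have e₃ : N.toBlocks₂₂ = 0 := ext_iff_trace_mul_right.mpr fun z' => by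
    simpa using hall 0 0 z'
  rw [hN, toBlocks_fromBlocks₁₁] at e₁
  rw [hN, toBlocks_fromBlocks₂₁] at e₂
  rw [hN, toBlocks_fromBlocks₂₂] at e₃
  refine ⟨?_, ?_, ?_⟩
  · simpa [sub_eq_zero] using e₁
  · simpa [sub_eq_zero] using e₂
  · simpa [sub_eq_zero] using e₃

theorem exists_eq_trace_mul [DecidableEq m] (G : Matrix m m K →ₗ[K] K) :
    ∃ f : Matrix m m K, ∀ M, G M = trace (f * M) := by
  refine ⟨of fun i j => G (single j i 1), fun M => ?_⟩
  conv_lhs => rw [matrix_eq_sum_single M]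
  simp only [map_sum, trace, diag_apply, mul_apply, of_apply]
  rw [Finset.sum_comm]
  refine Finset.sum_congr rfl fun i _ => Finset.sum_congr rfl fun j _ => ?_
  rw [← mul_one (M j i), ← smul_eq_mul, ← smul_single, map_smul, smul_eq_mul, smul_eq_mul,
    mul_one, mul_comm]

end Coadjoint

/-! ### The flag conditions as vanishing entries -/

section Parabolic

variable {K : Type*} [Field K] {n : ℕ}

theorem mem_initialSpan_iff {k : ℕ} {v : Fin n → K} :
    v ∈ initialSpan K n k ↔ ∀ i : Fin n, k ≤ (i : ℕ) → v i = 0 := by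
  rw [initialSpan]
  constructor
  · intro hv i hi
    have hle : Submodule.span K ((fun i : Fin n => (Pi.single i (1 : K) : Fin n → K)) ''
        {i | (i : ℕ) < k}) ≤ LinearMap.ker (LinearMap.proj (R := K) (φ := fun _ => K) i) := by
      rw [Submodule.span_le]
      rintro _ ⟨j, hj, rfl⟩
      have hji : i ≠ j := by rintro rfl; exact absurd hj (not_lt.mpr hi)
      simp [hji]
    exact hle hv
  · intro hv
    rw [pi_eq_sum_univ' v]
    refine Submodule.sum_mem _ fun i _ => ?_
    by_cases hi : (i : ℕ) < k
    · refine Submodule.smul_mem _ _ (Submodule.subset_span ⟨i, hi, ?_⟩)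
      ext j
      simp [Pi.single_apply]
    · simp [hv i (not_lt.mp hi)]

theorem preserves_initialSpan_iff {A : Matrix (Fin n) (Fin n) K} {k : ℕ} :
    Preserves K A (initialSpan K n k) ↔
      ∀ i j : Fin n, k ≤ (i : ℕ) → (j : ℕ) < k → A i j = 0 := by
  constructor
  · intro h i j hi hj
    have := mem_initialSpan_iff.mp (h (Pi.single j 1) (Submodule.subset_span ⟨j, hj, rfl⟩)) i hi
    simpa using this
  · intro h v hv
    rw [mem_initialSpan_iff] at hv ⊢
    intro i hi
    rw [mulVec, dotProduct]
    refine Finset.sum_eq_zero fun j _ => ?_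
    rcases lt_or_ge (j : ℕ) k with hj | hj
    · rw [h i j hi hj, zero_mul]
    · rw [hv j hj, mul_zero]

theorem finalSpan_zero : finalSpan K n 0 = (⊤ : Submodule K (Fin n → K)) := by
  rw [finalSpan, eq_top_iff]
  intro v _
  rw [pi_eq_sum_univ' v]
  refine Submodule.sum_mem _ fun i _ => Submodule.smul_mem _ _
    (Submodule.subset_span ⟨i, Nat.zero_le _, ?_⟩)
  ext j
  simp [Pi.single_apply]

theorem finalSpan_self : finalSpan K n n = (⊥ : Submodule K (Fin n → K)) := by
  rw [finalSpan, Submodule.span_eq_bot]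
  rintro _ ⟨i, hi, rfl⟩
  exact absurd i.isLt (not_lt.mpr hi)

theorem mem_parabolic_iff {a b : ℕ} (hab : ([a, b] : List ℕ).sum = n) (hn : ([n] : List ℕ).sum = n)
    (A : LieAlgebra.SpecialLinear.sl (Fin n) K) :
    A ∈ seaweed K (⟨[a, b], hab⟩ : WeakComposition n) (⟨[n], hn⟩ : WeakComposition n) ↔
      ∀ i j : Fin n, a ≤ (i : ℕ) → (j : ℕ) < a → A.val i j = 0 := by
  rw [← preserves_initialSpan_iff]
  have hab' : a + b = n := by simpa using hab
  constructor
  · intro h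
    simpa using h.1 1 (by simp)
  · refine fun h => ⟨fun i hi => ?_, fun j hj => ?_⟩
    · have hi' : i ≤ 2 := hi
      interval_cases i
      · exact preserves_initialSpan_iff.mpr fun i j _ hj => absurd hj (by simp)
      · simpa using h
      · refine preserves_initialSpan_iff.mpr fun i j hi _ => absurd i.isLt ?_
        have : a + b ≤ (i : ℕ) := by simpa using hi
        omega
    · have hj' : j ≤ 1 := hj
      interval_cases j
      · intro v _
        simp [finalSpan_zero]
      · intro v hv
        have hv' : v ∈ finalSpan K n n := by simpa using hv
        rw [finalSpan_self, Submodule.mem_bot] at hv'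
        rw [hv', mulVec_zero]
        exact zero_mem _

end Parabolic

theorem isFrobenius_iff (K : Type*) [Field K] (L : Type*) [LieRing L] [LieAlgebra K L] :
    IsFrobenius K L ↔ ∃ F : Module.Dual K L, ∀ X : L, (∀ Y : L, F ⁅X, Y⁆ = 0) → X = 0 := by
  rw [IsFrobenius, index, Cardinal.iInf_eq_zero_iff]
  simp only [not_isEmpty_of_nonempty, false_or, Submodule.rank_eq_zero]
  refine exists_congr fun F => ?_
  rw [LinearMap.ker_eq_bot']
  refine forall_congr' fun X => ?_
  rw [LinearMap.ext_iff]
  rfl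

/-! ### From the Lie algebra to block matrices -/

section Blocks

variable (K : Type*) [Field K] (a b : ℕ)

/-- The maximal parabolic subalgebra `𝔭(a, b | a + b)`. -/
abbrev parabolic : LieSubalgebra K (LieAlgebra.SpecialLinear.sl (Fin (a + b)) K) :=
  seaweed K (⟨[a, b], by simp⟩ : WeakComposition (a + b)) (⟨[a + b], by simp⟩)

/-- The elements of a maximal parabolic subalgebra as block matrices. -/
def toBlockMatrix : parabolic K a b →ₗ[K] Matrix (Fin a ⊕ Fin b) (Fin a ⊕ Fin b) K where
  toFun X := X.val.val.submatrix finSumFinEquiv finSumFinEquiv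
  map_add' _ _ := rfl
  map_smul' _ _ := rfl

variable {K a b}

@[simp]
theorem toBlockMatrix_apply (X : parabolic K a b) :
    toBlockMatrix K a b X = X.val.val.submatrix finSumFinEquiv finSumFinEquiv :=
  rfl

theorem toBlockMatrix_injective : Function.Injective (toBlockMatrix K a b) := by
  intro X Y h
  apply Subtype.ext
  apply Subtype.ext
  ext i j
  have := congrFun (congrFun h (finSumFinEquiv.symm i)) (finSumFinEquiv.symm j)
  simpa using this

theorem toBlockMatrix_lie (X Y : parabolic K a b) :
    toBlockMatrix K a b ⁅X, Y⁆ = toBlockMatrix K a b X * toBlockMatrix K a b Y -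
      toBlockMatrix K a b Y * toBlockMatrix K a b X := by
  have h : (⁅X, Y⁆ : parabolic K a b).val.val =
      X.val.val * Y.val.val - Y.val.val * X.val.val := rfl
  simp only [toBlockMatrix_apply, h, submatrix_mul_equiv]
  rfl

theorem exists_toBlockMatrix_eq (X : parabolic K a b) :
    ∃ x y z, toBlockMatrix K a b X = fromBlocks x y 0 z ∧ trace x + trace z = 0 := by
  have h21 : (toBlockMatrix K a b X).toBlocks₂₁ = 0 := by
    ext i j
    exact (mem_parabolic_iff _ _ X.val).mp X.property _ _ (by simp) (by simp)
  refine ⟨_, _, _, by conv_lhs => rw [← fromBlocks_toBlocks (toBlockMatrix K a b X), h21], ?_⟩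
  rw [← trace_eq_trace_toBlocks]
  have htr : trace X.val.val = 0 := X.val.property
  rw [← htr]
  exact Equiv.sum_comp finSumFinEquiv fun i => X.val.val i i

theorem exists_eq_toBlockMatrix (x : Matrix (Fin a) (Fin a) K) (y : Matrix (Fin a) (Fin b) K)
    (z : Matrix (Fin b) (Fin b) K) (h : trace x + trace z = 0) :
    ∃ X : parabolic K a b, toBlockMatrix K a b X = fromBlocks x y 0 z := by
  let M := (fromBlocks x y 0 z).submatrix finSumFinEquiv.symm finSumFinEquiv.symm
  have hM : M ∈ LieAlgebra.SpecialLinear.sl (Fin (a + b)) K := by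
    change trace M = 0
    rw [← h]
    refine Eq.trans ?_ (trace_eq_trace_toBlocks (fromBlocks x y 0 z))
    exact Equiv.sum_comp finSumFinEquiv.symm fun i => fromBlocks x y 0 z i i
  refine ⟨⟨⟨M, hM⟩, (mem_parabolic_iff _ _ _).mpr fun i j hi hj => ?_⟩, ?_⟩
  · obtain ⟨i, rfl⟩ := finSumFinEquiv.surjective i
    obtain ⟨j, rfl⟩ := finSumFinEquiv.surjective j
    rcases i with i | i
    · exact absurd i.isLt (not_lt.mpr hi)
    rcases j with j | j
    · simp [M]
    · simp at hj
  · simp [M]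

theorem isFrobenius_parabolic_iff [CharZero K] (hab : 0 < a + b) :
    IsFrobenius K (parabolic K a b) ↔ ExistsRigid K (Fin a) (Fin b) := by
  have hcard : ((a + b : ℕ) : K) ≠ 0 := Nat.cast_ne_zero.mpr hab.ne'
  rw [isFrobenius_iff]
  constructor
  · rintro ⟨F, hF⟩
    -- A linear retraction extends `F` to all matrices, where the trace form represents it.
    obtain ⟨r, hr⟩ := (toBlockMatrix K a b).exists_leftInverse_of_injective
      (LinearMap.ker_eq_bot.mpr toBlockMatrix_injective)
    obtain ⟨f, hf⟩ := exists_eq_trace_mul (F ∘ₗ r)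
    have hFf : ∀ X, F X = trace (f * toBlockMatrix K a b X) := fun X => by
      rw [← hf]
      exact congrArg F (LinearMap.congr_fun hr X).symm
    refine ⟨f.toBlocks₁₁, f.toBlocks₂₁, f.toBlocks₂₂, fun x y z h1 h2 h3 => ?_⟩
    obtain ⟨c, hc⟩ : ∃ c : K, c * ((a + b : ℕ) : K) = trace x + trace z :=
      ⟨_, div_mul_cancel₀ _ hcard⟩
    obtain ⟨X, hX⟩ := exists_eq_toBlockMatrix (x - c • 1) y (z - c • 1) (by
      simp only [trace_sub, trace_smul, trace_one, smul_eq_mul, Fintype.card_fin]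
      push_cast at hc
      linear_combination -hc)
    have hX0 := hF X fun Y => by
      obtain ⟨x', y', z', hY, -⟩ := exists_toBlockMatrix_eq Y
      rw [hFf, toBlockMatrix_lie, hX, hY, ← fromBlocks_toBlocks f]
      refine trace_fromBlocks_mul_commutator_eq_zero ?_ ?_ ?_ x' y' z'
      · rw [mul_sub, sub_mul, h1]
        simp only [mul_smul_comm, smul_mul_assoc, mul_one, one_mul]
        abel
      · simp [Matrix.mul_sub, Matrix.sub_mul, h2]
      · rw [mul_sub, sub_mul, ← h3]
        simp only [mul_smul_comm, smul_mul_assoc, mul_one, one_mul]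
        abel
    rw [hX0, map_zero, ← fromBlocks_zero, fromBlocks_inj] at hX
    exact ⟨c, (sub_eq_zero.mp hX.1.symm), hX.2.1.symm, (sub_eq_zero.mp hX.2.2.2.symm)⟩
  · rintro ⟨A, C, D, h⟩
    refine ⟨traceLinearMap _ K K ∘ₗ LinearMap.mulLeft K (fromBlocks A 0 C D) ∘ₗ
      toBlockMatrix K a b, fun X hX => ?_⟩
    obtain ⟨x, y, z, hxyz, htr⟩ := exists_toBlockMatrix_eq X
    obtain ⟨h1, h2, h3⟩ := equations_of_trace_mul_commutator_eq_zero (x := x) (y := y) (z := z)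
      (A := A) (C := C) (D := D) (by simpa using hcard) (fun x' y' z' h' => by
        obtain ⟨Y, hY⟩ := exists_eq_toBlockMatrix x' y' z' h'
        rw [← hY, ← hxyz, ← toBlockMatrix_lie]
        exact hX Y)
    obtain ⟨c, rfl, rfl, rfl⟩ := h x y z h1 h2 h3
    -- A scalar of trace zero vanishes because `a + b ≠ 0` in `K`.
    have hc : c = 0 := by
      simp only [trace_smul, trace_one, smul_eq_mul, Fintype.card_fin, ← mul_add] at htr
      refine (mul_eq_zero.mp htr).resolve_right ?_
      exact_mod_cast hcard
    apply toBlockMatrix_injective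
    rw [hxyz, hc]
    simp

end Blocks

end Seaweed

theorem mainTheorem4 (K : Type*) [Field K] [CharZero K] (a b n : ℕ) (hn : 0 < n)
    (hab : a + b = n) :
    Seaweed.IsFrobenius K
        (Seaweed.seaweed K (⟨[a, b], by simpa using hab⟩ : Seaweed.WeakComposition n)
          (⟨[n], by simp⟩ : Seaweed.WeakComposition n)) ↔
      Nat.gcd a n = 1 := by
  subst hab
  rw [Nat.gcd_self_add_right, ← Seaweed.existsRigid_fin_iff K a b hn]
  exact Seaweed.isFrobenius_parabolic_iff hn
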